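/- **Setting.** Let $\mathbb T=\bigcup_{n\ge 0}\{1,2\}^n$ be the full binary tree with root $\theta$; $v|j$ denotes the ancestor of $v$ in generation $j\le |v|$, and for an infinite path $s\in\{1,2\}^{\infty}$, $s|n$ denotes its vertex in generation $n$. A *doubly stochastic Yule (DSY) cascade* with positive random intensities $(\lambda_v)_{v\in\mathbb T}$ is a family $(\lambda_v^{-1}T_v)_{v\in\mathbb T}$ in which $(T_v)_{v\in\mathbb T}$ are i.i.d. mean-one exponential random variables and the family $(\lambda_v)$ is independent of the family $(T_v)$. Its explosion time is $$\zeta=\sup_{n\ge 0}\ \min_{|v|=n}\ \sum_{j=0}^{n}\frac{T_{v|j}}{\lambda_{v|j}}\in[0,\infty],$$ and it is *non-explosive* if $\mathbb P(\zeta=\infty)=1$. It is *of type $(\mathcal M)$* with transition kernel $p(x,dy)$ if $\lambda_v=\lambda(X_v)$ for a $(0,\infty)$-valued function $\lambda$ and random variables $(X_v)_{v\in\mathbb T}$ such that along every path $s$ the sequence $X_{s|0},X_{s|1},X_{s|2},\dots$ is a time-homogeneous Markov chain with the (same) transition kernel $p$. **KPP data.** On $\mathbb R$ let $\lambda(\xi)=1+\xi^2$,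 let $h(\xi)=3\xi\,\mathrm{csch}(\pi\xi)$ (with $h(0)=3/\pi$, the continuous extension), and $$p(\xi,\eta)=H(\eta|\xi)=\frac{h(\eta)\,h(\xi-\eta)}{(1+\xi^2)\,h(\xi)},\qquad \gamma(d\xi)=\frac{5\pi}{18}\,(1+\xi^2)\,h(\xi)^2\,d\xi .$$ **Statement.** 1. $h>0$, and $\eta\mapsto h(\eta)h(\xi-\eta)$ is integrable with $(h*h)(\xi)=(1+\xi^2)h(\xi)$ for every $\xi\in\mathbb R$; $H(\eta|\xi)\,d\eta$ is a probability kernel on $\mathbb R$. 2. $\gamma$ is a probability measure; the kernel $H(\eta|\xi)\,d\eta$ is reversible with respect to $\gamma$; $\gamma$ is its unique invariant probability measure; and it is ergodic, that is, every measurable $A\subseteq\mathbb R$ with $\int_A H(\eta|x)\,d\eta=\mathbf 1_A(x)$ for $\gamma$-a.e. $x$ has $\gamma(A)\in\{0,1\}$. Moreover $H(\eta|\xi)\,d\eta\ll\gamma(d\eta)\ll d\eta$ for every $\xi\in\mathbb R$. 3. The trace condition holds: with $g_1=\lambda/(1+\lambda)$ and $p^{(2)}(\xi,\xi)=\int_{\mathbb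 R}p(\xi,\eta)\,p(\eta,\xi)\,d\eta$, $$\int_{\mathbb R} g_1(\xi)^2\,p^{(2)}(\xi,\xi)\,d\xi<\infty,\qquad\text{and even}\qquad \int_{\mathbb R}p^{(2)}(\xi,\xi)\,d\xi<\infty .$$ 4. Every DSY cascade of type $(\mathcal M)$ with $\lambda(\xi)=1+\xi^2$ and transition kernel $H(\eta|\xi)\,d\eta$, started from $X_\theta=\xi$, is non-explosive, for every initial wave number $\xi\in\mathbb R$. -/

import Mathlib

open MeasureTheory ProbabilityTheory
open scoped ENNReal

namespace Cascade

/-- Vertices of the full binary tree: finite words over a two-letter alphabet, the root being the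
empty word. The ancestor of `v` in generation `j ≤ |v|` is `v.take j`. -/
abbrev Vertex : Type := List (Fin 2)

/-- The vertex `s|n` in generation `n` on an infinite path `s`. -/
def restrict (s : ℕ → Fin 2) (n : ℕ) : Vertex := (List.range n).map s

section General

variable {Ω : Type*} [MeasurableSpace Ω] {S : Type*} [MeasurableSpace S]

/-- The families `T` and `lam` form a doubly stochastic Yule cascade `(T v / lam v)`: the `T v` are
i.i.d. exponential with mean one, the intensities `lam v` are positive random variables, and the
family of intensities is independent of the family `T`. -/
structure IsDSY (lam T : Vertex → Ω → ℝ) (P : Measure Ω) : Prop where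
  measurable_lam : ∀ v, Measurable (lam v)
  lam_pos : ∀ v ω, 0 < lam v ω
  measurable_T : ∀ v, Measurable (T v)
  law_T : ∀ v, HasLaw (T v) (expMeasure 1) P
  indep_T : iIndepFun T P
  indep_lam_T : IndepFun (fun ω v => lam v ω) (fun ω v => T v ω) P

/-- The explosion time `ζ = sup_n min_{|v| = n} ∑_{j = 0}^n T_{v|j} / lam_{v|j}`, with values in
`[0, ∞]`. -/
noncomputable def explosionTime (lam T : Vertex → Ω → ℝ) (ω : Ω) : ℝ≥0∞ :=
  ⨆ n : ℕ, ⨅ (v : Vertex) (_ : v.length = n),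
    ∑ j ∈ Finset.range (n + 1), ENNReal.ofReal (T (v.take j) ω / lam (v.take j) ω)

/-- The cascade is non-explosive: `P (ζ = ∞) = 1`. -/
def IsNonExplosive (lam T : Vertex → Ω → ℝ) (P : Measure Ω) : Prop :=
  P {ω | explosionTime lam T ω = ⊤} = 1

/-- `Y 0, Y 1, …` is a time-homogeneous Markov chain with transition kernel `κ`: the conditional
distribution of `Y (n + 1)` given `(Y 0, …, Y n)` is `κ (Y n)`. -/
def IsMarkovChain (κ : Kernel S S) [IsSFiniteKernel κ] (Y : ℕ → Ω → S) (P : Measure Ω) : Prop :=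
  ∀ n : ℕ, HasCondDistrib (Y (n + 1)) (fun ω (i : Fin (n + 1)) => Y i ω)
    (κ.comap (fun y : Fin (n + 1) → S => y (Fin.last n)) (measurable_pi_apply _)) P

/-- The cascade `(T v / lam (X v))` is a doubly stochastic Yule cascade of type (M) with transition
kernel `κ`: along every path of the tree the states `X` form a time-homogeneous Markov chain with
the same transition kernel `κ`. -/
structure IsTypeM (κ : Kernel S S) [IsSFiniteKernel κ] (lam : S → ℝ) (X : Vertex → Ω → S)
    (T : Vertex → Ω → ℝ) (P : Measure Ω) : Prop where
  lam_pos : ∀ x, 0 < lam x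
  measurable_X : ∀ v, Measurable (X v)
  isDSY : IsDSY (fun v ω => lam (X v ω)) T P
  markov : ∀ s : ℕ → Fin 2, IsMarkovChain κ (fun n => X (restrict s n)) P

/-- The diagonal of the two-step transition density, `p⁽²⁾(x, x) = ∫ p(x, z) p(z, x) m(dz)`. -/
noncomputable def twoStepDiag (p : S → S → ℝ) (m : Measure S) (x : S) : ℝ≥0∞ :=
  ∫⁻ z, ENNReal.ofReal (p x z) * ENNReal.ofReal (p z x) ∂m

/-- The trace condition `∫ g₁(x)² p⁽²⁾(x, x) m(dx) < ∞`, where `g₁ = lam / (1 + lam)`. -/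
def TraceCondition (lam : S → ℝ) (p : S → S → ℝ) (m : Measure S) : Prop :=
  ∫⁻ x, ENNReal.ofReal ((lam x / (1 + lam x)) ^ 2) * twoStepDiag p m x ∂m < ⊤

end General

end Cascade

namespace KPP

/-- The majorizing kernel `h(ξ) = 3 ξ csch(π ξ)`, extended by continuity by `h(0) = 3 / π`. -/
noncomputable def h (ξ : ℝ) : ℝ :=
  if ξ = 0 then 3 / Real.pi else 3 * ξ / Real.sinh (Real.pi * ξ)

/-- The intensity function `λ(ξ) = 1 + ξ²`. -/
def lam (ξ : ℝ) : ℝ := 1 + ξ ^ 2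

/-- The transition density `p(ξ, η) = H(η | ξ) = h(η) h(ξ - η) / ((1 + ξ²) h(ξ))`. -/
noncomputable def dens (ξ η : ℝ) : ℝ := h η * h (ξ - η) / ((1 + ξ ^ 2) * h ξ)

lemma measurable_h : Measurable h := by
  unfold h
  refine Measurable.ite (measurableSet_singleton 0) measurable_const ?_
  have : Measurable fun ξ : ℝ => Real.sinh (Real.pi * ξ) :=
    Real.measurable_sinh.comp (measurable_const.mul measurable_id)
  fun_prop

lemma measurable_dens : Measurable (fun q : ℝ × ℝ => dens q.1 q.2) := by
  unfold dens
  have := measurable_h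
  fun_prop

/-- The transition kernel `H(η | ξ) dη`. -/
noncomputable def kernel : Kernel ℝ ℝ where
  toFun ξ := volume.withDensity fun η => ENNReal.ofReal (dens ξ η)
  measurable' := by
    refine Measure.measurable_of_measurable_coe _ fun s hs => ?_
    simp only [withDensity_apply _ hs]
    exact Measurable.lintegral_prod_right' (f := fun q : ℝ × ℝ => ENNReal.ofReal (dens q.1 q.2))
      measurable_dens.ennreal_ofReal

lemma kernel_eq_withDensity :
    kernel = (Kernel.const ℝ (volume : Measure ℝ)).withDensity
      (fun ξ η => ENNReal.ofReal (dens ξ η)) := by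
  ext1 ξ
  rw [Kernel.withDensity_apply _ measurable_dens.ennreal_ofReal]
  rfl

instance isSFiniteKernel_kernel : IsSFiniteKernel kernel := by
  rw [kernel_eq_withDensity]
  exact Kernel.IsSFiniteKernel.withDensity _ fun _ _ => ENNReal.ofReal_ne_top

/-- The measure `γ(dξ) = (5π/18) (1 + ξ²) h(ξ)² dξ`. -/
noncomputable def γ : Measure ℝ :=
  volume.withDensity fun ξ => ENNReal.ofReal (5 * Real.pi / 18 * ((1 + ξ ^ 2) * h ξ ^ 2))

end KPP

/-! ### Elementary properties of `h`: parity, positivity, continuity, decay -/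

namespace KPP

/-! The convolution identity is an explicit computation. Multiplied by `sinh (π ξ)` and expanded
with the addition formula, `h η * h (ξ - η)` splits into a polynomial piece supported on `[0, ξ]`
and two exponentially damped pieces whose integrals reduce to `ζ(2)`. The normalisation of `γ` needs
only this identity at `0` and `ζ(4)`. Up to a constant, `γ(dξ) H(η | ξ) dη` has the symmetric
density `h ξ * h η * h (ξ - η)`, hence reversibility; strict positivity of the transition densities
gives ergodicity and uniqueness.

Non-explosion pits a first-moment bound over the `2 ^ n` vertices of generation `n` against a
Hilbert-Schmidt estimate. Given the intensities, the Laplace transform at `θ` of the arrival time at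
a vertex is the product of the factors `λ / (λ + θ)` along its ancestral line, so by the Chernoff
bound everything rests on the expectation of that product: a Feynman-Kac functional, obtained by
iterating the transition operator damped by `λ / (λ + θ)`. By reversibility this operator has
squared Hilbert-Schmidt norm `∫ (λ / (λ + θ))² p⁽²⁾(x, x) dx` on `L²(γ)`. The unweighted trace is
finite, so by dominated convergence the norm tends to `0` as `θ → ∞`. Once its square is at most
`1/8`, the functional is `O(8 ^ (-n/2))`, which beats `2 ^ n`
(`exists_tendsto_two_pow_mul_feynmanKac`, `IsDSY.isNonExplosive`). -/

lemma h_zero : h 0 = 3 / Real.pi := by simp [h]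

lemma h_of_ne {x : ℝ} (hx : x ≠ 0) : h x = 3 * x / Real.sinh (Real.pi * x) := by simp [h, hx]

lemma h_neg (x : ℝ) : h (-x) = h x := by
  by_cases hx : x = 0
  · simp [hx]
  · rw [h_of_ne hx, h_of_ne (neg_ne_zero.2 hx), mul_neg, mul_neg, Real.sinh_neg, neg_div_neg_eq]

lemma h_abs (x : ℝ) : h |x| = h x := by
  rcases abs_choice x with hx | hx <;> rw [hx]
  exact h_neg x

lemma h_mul_sinh (x : ℝ) : h x * Real.sinh (Real.pi * x) = 3 * x := by
  by_cases hx : x = 0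
  · simp [hx]
  · have : Real.sinh (Real.pi * x) ≠ 0 := by
      rw [Ne, Real.sinh_eq_zero]; exact mul_ne_zero Real.pi_ne_zero hx
    rw [h_of_ne hx, div_mul_cancel₀ _ this]

lemma h_pos (x : ℝ) : 0 < h x := by
  rw [← h_abs]
  rcases (abs_nonneg x).eq_or_lt with hx | hx
  · rw [← hx, h_zero]; positivity
  · rw [h_of_ne hx.ne']
    have : 0 < Real.sinh (Real.pi * |x|) := Real.sinh_pos_iff.2 (by positivity)
    positivity

lemma continuous_h : Continuous h := by
  have hd : ∀ y : ℝ, HasDerivAt (fun x => Real.sinh (Real.pi * x))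
      (Real.cosh (Real.pi * y) * Real.pi) y := fun y => by
    simpa using (((hasDerivAt_id y).const_mul Real.pi).sinh)
  -- The removable singularity at `0`: `h` is `3` divided by the difference quotient of `sinh (π x)`
  -- at `0`, completed there by the derivative `π`.
  have hc : Continuous (dslope (fun x => Real.sinh (Real.pi * x)) 0) := by
    rw [continuous_iff_continuousAt]
    intro y
    by_cases hy : y = 0
    · subst hy; exact continuousAt_dslope_same.2 (hd 0).differentiableAt
    · exact (continuousAt_dslope_of_ne hy).2 (hd y).continuousAt
  have he : ∀ x, h x * dslope (fun x => Real.sinh (Real.pi * x)) 0 x = 3 := by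
    intro x
    by_cases hx : x = 0
    · subst hx
      rw [dslope_same, (hd 0).deriv, h_zero]
      simp [Real.pi_ne_zero]
    · rw [dslope_of_ne _ hx, slope_def_field]
      have := h_mul_sinh x
      simp only [mul_zero, Real.sinh_zero, sub_zero]
      rw [← mul_div_assoc, this, mul_div_assoc, div_self hx, mul_one]
  have : h = fun x => 3 / dslope (fun x => Real.sinh (Real.pi * x)) 0 x := by
    ext x
    rw [eq_div_iff, he]
    intro h0; have := he x; simp [h0] at this
  rw [this]
  refine continuous_const.div hc fun x h0 => ?_
  have := he x; simp [h0] at this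

/-- Equivalent for `y = |x| > 0` to `π y (1 + y²) ≤ sinh (π y)`. Halving the angle, `sinh (π y / 2)
≥ π y / 2` and `cosh (π y / 2) ≥ 1 + π² y² / 8`, and `π² > 8`. This gives integrability of `h` and
of the density of `γ`. -/
lemma one_add_sq_mul_h_le (x : ℝ) : (1 + x ^ 2) * h x ≤ 3 / Real.pi := by
  rw [← h_abs, ← sq_abs]
  rcases (abs_nonneg x).eq_or_lt with hx | hx
  · rw [← hx, h_zero]; simp
  · generalize |x| = y at hx
    have hpi := Real.pi_gt_three
    have h1 : Real.pi * y / 2 ≤ Real.sinh (Real.pi * y / 2) :=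
      Real.self_le_sinh_iff.2 (by positivity)
    have h2 : 1 + (Real.pi * y / 2) ^ 2 / 2 ≤ Real.cosh (Real.pi * y / 2) := by
      have e1 : Real.pi * y / 4 ≤ Real.sinh (Real.pi * y / 4) :=
        Real.self_le_sinh_iff.2 (by positivity)
      have e2 : 0 ≤ Real.pi * y / 4 := by positivity
      have e3 := Real.cosh_two_mul (Real.pi * y / 4)
      rw [Real.cosh_sq, show 2 * (Real.pi * y / 4) = Real.pi * y / 2 by ring] at e3
      nlinarith
    have h3 : Real.sinh (Real.pi * y)
        = 2 * Real.sinh (Real.pi * y / 2) * Real.cosh (Real.pi * y / 2) := by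
      rw [← Real.sinh_two_mul]; ring_nf
    have h4 : 1 + y ^ 2 ≤ Real.cosh (Real.pi * y / 2) := by
      nlinarith [mul_nonneg (sq_nonneg y) (by nlinarith : (0:ℝ) ≤ Real.pi ^ 2 - 8)]
    have h5 : Real.pi * y * (1 + y ^ 2) ≤ Real.sinh (Real.pi * y) := by
      rw [h3]
      exact mul_le_mul (by linarith) h4 (by positivity) (by linarith [mul_pos Real.pi_pos hx])
    rw [h_of_ne hx.ne', ← mul_div_assoc, div_le_div_iff₀ (lt_of_lt_of_le (by positivity) h5)
      Real.pi_pos]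
    linarith

lemma h_le (x : ℝ) : h x ≤ 3 / Real.pi * (1 + x ^ 2)⁻¹ := by
  rw [← div_eq_mul_inv, le_div_iff₀ (by positivity), mul_comm]
  exact one_add_sq_mul_h_le x

lemma h_le_const (x : ℝ) : h x ≤ 3 / Real.pi := by
  have := one_add_sq_mul_h_le x
  nlinarith [h_pos x, mul_nonneg (sq_nonneg x) (h_pos x).le]

lemma integrable_h : Integrable h := by
  refine Integrable.mono' (integrable_inv_one_add_sq.const_mul (3 / Real.pi))
    continuous_h.aestronglyMeasurable (ae_of_all _ fun x => ?_)
  rw [Real.norm_of_nonneg (h_pos x).le]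
  exact h_le x

lemma integrable_h_mul_h_sub (ξ : ℝ) : Integrable fun η => h η * h (ξ - η) := by
  refine Integrable.mul_bdd (c := 3 / Real.pi) integrable_h
    (continuous_h.comp (continuous_const.sub continuous_id)).aestronglyMeasurable
    (ae_of_all _ fun x => ?_)
  rw [Real.norm_of_nonneg (h_pos _).le]
  exact h_le_const _

lemma continuous_integral_h_mul_h_sub : Continuous fun ξ => ∫ η, h η * h (ξ - η) := by
  refine continuous_of_dominated (bound := fun η => h η * (3 / Real.pi)) (fun ξ => ?_)
    (fun ξ => ae_of_all _ fun η => ?_) (integrable_h.mul_const _) (ae_of_all _ fun η => ?_)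
  · exact (integrable_h_mul_h_sub ξ).aestronglyMeasurable
  · rw [Real.norm_of_nonneg (mul_nonneg (h_pos _).le (h_pos _).le)]
    exact mul_le_mul_of_nonneg_left (h_le_const _) (h_pos _).le
  · exact continuous_const.mul (continuous_h.comp (continuous_id.sub continuous_const))

lemma hasSum_of_forall_eq {f g : ℕ → ℝ} {a b : ℝ} (hg : HasSum g b) (hfg : ∀ n, f n = g n)
    (hab : a = b) : HasSum f a := by
  rwa [funext hfg, hab]

/-! ### Two explicit integrals through zeta values -/

/-- Termwise integration of an exponential series over the half-line. -/
lemma integral_pow_mul_tsum_exp {k : ℕ} {c : ℕ → ℝ} {f : ℝ → ℝ} {A : ℝ} (hc : ∀ n, 0 ≤ c n)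
    (hf : ∀ x, 0 < x → HasSum (fun n : ℕ => c n * Real.exp (-(2 * Real.pi * (n + 1)) * x)) (f x))
    (hA : HasSum (fun n : ℕ => c n * (k.factorial / (2 * Real.pi * (n + 1)) ^ (k + 1))) A) :
    ∫ x in Set.Ioi 0, x ^ k * f x = A := by
  have hi : ∀ n : ℕ, ∫ x in Set.Ioi (0 : ℝ), x ^ k * Real.exp (-((2 * Real.pi * (n + 1)) * x))
      = k.factorial / (2 * Real.pi * (n + 1)) ^ (k + 1) := by
    intro n
    have := Real.integral_rpow_mul_exp_neg_mul_Ioi (a := k + 1) (r := 2 * Real.pi * (n + 1))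
      (by positivity) (by positivity)
    rw [Real.Gamma_nat_eq_factorial] at this
    simp only [add_sub_cancel_right, Real.rpow_natCast] at this
    rw [this]
    norm_cast
    rw [one_div, inv_pow]; ring_nf
  have hint : ∀ n : ℕ, IntegrableOn
      (fun x : ℝ => x ^ k * Real.exp (-((2 * Real.pi * (n + 1)) * x))) (Set.Ioi 0) := by
    -- A Bochner integral that does not converge is `0` by convention, whereas the value computed in
    -- `hi` is positive.
    intro n
    by_contra hn
    have := hi n
    rw [integral_undef hn] at this
    have h2 : (0 : ℝ) < k.factorial / (2 * Real.pi * (n + 1)) ^ (k + 1) := by positivity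
    linarith
  set F : ℕ → ℝ → ℝ := fun n x => c n * (x ^ k * Real.exp (-((2 * Real.pi * (n + 1)) * x))) with hF
  have hFi : ∀ n, ∫ x in Set.Ioi 0, F n x
      = c n * (k.factorial / (2 * Real.pi * (n + 1)) ^ (k + 1)) := fun n => by
    rw [hF, integral_const_mul, hi]
  have hFn : ∀ n, ∫ x in Set.Ioi 0, ‖F n x‖ = ∫ x in Set.Ioi 0, F n x := fun n => by
    refine setIntegral_congr_fun measurableSet_Ioi fun x hx => ?_
    have := hc n
    have hx : (0 : ℝ) < x := hx
    exact Real.norm_of_nonneg (by positivity)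
  have := hasSum_integral_of_summable_integral_norm (F := F)
    (μ := volume.restrict (Set.Ioi 0)) (fun n => (hint n).const_mul (c n))
    (by simpa only [hFn, hFi] using hA.summable)
  simp only [hFi] at this
  rw [hA.unique this]
  refine setIntegral_congr_fun measurableSet_Ioi fun x hx => ?_
  have h3 := (hf x hx).mul_left (x ^ k)
  simp only [hF]
  rw [← h3.tsum_eq]
  refine tsum_congr fun n => ?_
  rw [neg_mul]; ring

lemma exp_neg_two_pi_lt_one {x : ℝ} (hx : 0 < x) : Real.exp (-(2 * Real.pi * x)) < 1 := by
  rw [Real.exp_lt_one_iff]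
  have := Real.pi_pos
  simp; positivity

/-- With `q = exp (-π x)` one has `sinh (π x) = (1 - q²) / (2 q)`, leaving a geometric series in
`q²`; its derivative gives the squared case `hasSum_exp_series_two`. -/
lemma hasSum_exp_series_one {x : ℝ} (hx : 0 < x) :
    HasSum (fun n : ℕ => 6 * Real.exp (-(2 * Real.pi * (n + 1)) * x))
      (3 * Real.exp (-(Real.pi * x)) / Real.sinh (Real.pi * x)) := by
  set q := Real.exp (-(Real.pi * x)) with hq
  have hq0 : 0 < q := Real.exp_pos _
  have hq2 : q ^ 2 = Real.exp (-(2 * Real.pi * x)) := by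
    rw [hq, ← Real.exp_nat_mul]; push_cast; ring_nf
  have hlt : q ^ 2 < 1 := by rw [hq2]; exact exp_neg_two_pi_lt_one hx
  have hs : Real.sinh (Real.pi * x) = (1 - q ^ 2) / (2 * q) := by
    rw [Real.sinh_eq, ← hq, show Real.exp (Real.pi * x) = q⁻¹ by rw [hq, Real.exp_neg, inv_inv]]
    field_simp
  have := (hasSum_geometric_of_lt_one (sq_nonneg q) hlt).mul_left (6 * q ^ 2)
  refine hasSum_of_forall_eq this (fun n => ?_) ?_
  · rw [mul_assoc 6 (q ^ 2), ← pow_succ', hq2, ← Real.exp_nat_mul]; push_cast; ring_nf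
  · rw [hs]
    have : 1 - q ^ 2 ≠ 0 := by linarith
    field_simp; norm_num

lemma hasSum_exp_series_two {x : ℝ} (hx : 0 < x) :
    HasSum (fun n : ℕ => 36 * (n + 1 : ℝ) * Real.exp (-(2 * Real.pi * (n + 1)) * x))
      (9 / Real.sinh (Real.pi * x) ^ 2) := by
  set q := Real.exp (-(Real.pi * x)) with hq
  have hq0 : 0 < q := Real.exp_pos _
  have hq2 : q ^ 2 = Real.exp (-(2 * Real.pi * x)) := by
    rw [hq, ← Real.exp_nat_mul]; push_cast; ring_nf
  have hlt : q ^ 2 < 1 := by rw [hq2]; exact exp_neg_two_pi_lt_one hx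
  have hs : Real.sinh (Real.pi * x) = (1 - q ^ 2) / (2 * q) := by
    rw [Real.sinh_eq, ← hq, show Real.exp (Real.pi * x) = q⁻¹ by rw [hq, Real.exp_neg, inv_inv]]
    field_simp
  have h1 := (hasSum_coe_mul_geometric_of_norm_lt_one
    (r := q ^ 2) (by rwa [Real.norm_of_nonneg (sq_nonneg q)])).mul_left 36
  have := (hasSum_nat_add_iff' 1).2 h1
  refine hasSum_of_forall_eq this (fun n => ?_) ?_
  · rw [hq2, ← Real.exp_nat_mul, mul_assoc]; push_cast; ring_nf
  · rw [hs]
    have : 1 - q ^ 2 ≠ 0 := by linarith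
    simp
    field_simp; norm_num

lemma integral_Ioi_h_mul_exp : ∫ x in Set.Ioi 0, h x * Real.exp (-(Real.pi * x)) = 1 / 4 := by
  rw [← integral_pow_mul_tsum_exp (k := 1) (c := fun _ => 6) (fun _ => by norm_num)
    (fun x hx => hasSum_exp_series_one hx) (A := 1 / 4)]
  · refine setIntegral_congr_fun measurableSet_Ioi fun x hx => ?_
    rw [h_of_ne (ne_of_gt hx)]; ring
  -- The series becomes `6 / (4 π²) * ζ(2)`; the shift by one drops the term at `0`, which is `1 / 0
  -- = 0`.
  · have := ((hasSum_nat_add_iff' 1).2 hasSum_zeta_two).mul_left (6 / (4 * Real.pi ^ 2))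
    refine hasSum_of_forall_eq this (fun n => ?_) ?_
    · push_cast; simp only [Nat.factorial]; field_simp; norm_num
    · simp; field_simp

lemma integral_Ioi_sq_mul_h_sq : ∫ x in Set.Ioi 0, x ^ 2 * h x ^ 2 = 3 / (10 * Real.pi) := by
  rw [← integral_pow_mul_tsum_exp (k := 4) (c := fun n => 36 * (n + 1 : ℝ))
    (fun _ => by positivity)
    (fun x hx => hasSum_exp_series_two hx) (A := 3 / (10 * Real.pi))]
  · refine setIntegral_congr_fun measurableSet_Ioi fun x hx => ?_
    rw [h_of_ne (ne_of_gt hx)]; ring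
  · have := ((hasSum_nat_add_iff' 1).2 hasSum_zeta_four).mul_left (27 / Real.pi ^ 5)
    refine hasSum_of_forall_eq this (fun n => ?_) ?_
    · push_cast; simp only [Nat.factorial]; field_simp; norm_num
    · simp; field_simp; norm_num

end KPP

/-! ### The convolution identity -/

namespace KPP

lemma integrable_h_mul_exp : Integrable fun x => h x * Real.exp (-(Real.pi * |x|)) := by
  refine Integrable.mul_bdd (c := 1) integrable_h (by fun_prop) (ae_of_all _ fun x => ?_)
  rw [Real.norm_of_nonneg (Real.exp_pos _).le, Real.exp_le_one_iff]
  have := Real.pi_pos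
  simp; positivity

lemma integrable_mul_h_mul_exp :
    Integrable fun x => x * (h x * Real.exp (-(Real.pi * |x|))) := by
  refine Integrable.mono' integrable_h (by have := continuous_h; fun_prop)
    (ae_of_all _ fun x => ?_)
  have h0 := h_pos x
  rw [norm_mul, norm_mul, Real.norm_of_nonneg h0.le, Real.norm_of_nonneg (Real.exp_pos _).le,
    Real.norm_eq_abs]
  have h1 : |x| * Real.exp (-(Real.pi * |x|)) ≤ 1 := by
    rw [Real.exp_neg, ← div_eq_mul_inv, div_le_one (Real.exp_pos _)]
    have := Real.add_one_le_exp (Real.pi * |x|)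
    nlinarith [abs_nonneg x, Real.pi_gt_three]
  nlinarith

lemma integral_h_mul_exp : ∫ x, h x * Real.exp (-(Real.pi * |x|)) = 1 / 2 := by
  have := integral_comp_abs (f := fun x => h x * Real.exp (-(Real.pi * x)))
  simp only [h_abs] at this
  rw [this, integral_Ioi_h_mul_exp]; norm_num

lemma integral_mul_h_mul_exp : ∫ x, x * (h x * Real.exp (-(Real.pi * |x|))) = 0 := by
  have := integral_neg_eq_self (fun x => x * (h x * Real.exp (-(Real.pi * |x|)))) volume
  simp only [h_neg, abs_neg, neg_mul, integral_neg] at this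
  linarith

/-- Since `cosh t = sinh t + exp (-t)` at `t = π |x|`, the growing part of `h * cosh` is exactly `3
|x|` and the rest is integrable. -/
lemma h_mul_cosh (x : ℝ) :
    h x * Real.cosh (Real.pi * x) = 3 * |x| + h x * Real.exp (-(Real.pi * |x|)) := by
  have h1 := h_mul_sinh |x|
  rw [h_abs] at h1
  have h2 : Real.cosh (Real.pi * |x|) = Real.cosh (Real.pi * x) := by
    rw [← Real.cosh_abs (Real.pi * x), abs_mul, abs_of_pos Real.pi_pos]
  rw [← h1, ← h2, ← mul_add, Real.cosh_eq, Real.sinh_eq]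
  ring

lemma sinh_mul_h_mul_h_sub (ξ η : ℝ) : Real.sinh (Real.pi * ξ) * (h η * h (ξ - η))
    = 9 * (η * |ξ - η| + (ξ - η) * |η|)
      + 3 * (η * (h (ξ - η) * Real.exp (-(Real.pi * |ξ - η|))))
      + 3 * ((ξ - η) * (h η * Real.exp (-(Real.pi * |η|)))) := by
  have h1 := h_mul_cosh η
  have h2 := h_mul_cosh (ξ - η)
  have h3 := h_mul_sinh η
  have h4 := h_mul_sinh (ξ - η)
  have h5 : Real.sinh (Real.pi * ξ) = Real.sinh (Real.pi * η) * Real.cosh (Real.pi * (ξ - η))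
      + Real.cosh (Real.pi * η) * Real.sinh (Real.pi * (ξ - η)) := by
    rw [← Real.sinh_add]; ring_nf
  have h6 : Real.sinh (Real.pi * ξ) * (h η * h (ξ - η))
      = 3 * η * (h (ξ - η) * Real.cosh (Real.pi * (ξ - η)))
        + 3 * (ξ - η) * (h η * Real.cosh (Real.pi * η)) := by
    rw [h5, ← h3, ← h4]; ring
  rw [h6, h1, h2]; ring

/-- Outside `[0, ξ]` the factors `η` and `ξ - η` have opposite signs, so the two non-integrable
terms cancel. -/
lemma mul_abs_sub_add_eq_indicator {ξ : ℝ} (hξ : 0 < ξ) :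
    (fun η : ℝ => η * |ξ - η| + (ξ - η) * |η|)
      = (Set.Ioc 0 ξ).indicator fun η => 2 * (ξ * η - η ^ 2) := by
  ext η
  by_cases h1 : 0 < η
  · by_cases h2 : η ≤ ξ
    · rw [Set.indicator_of_mem (Set.mem_Ioc.2 ⟨h1, h2⟩), abs_of_pos h1,
        abs_of_nonneg (by linarith)]; ring
    · rw [Set.indicator_of_notMem (by simp [h2]), abs_of_pos h1, abs_of_nonpos (by linarith)]; ring
  · rw [Set.indicator_of_notMem (by simp [h1]), abs_of_nonneg (a := ξ - η) (by linarith),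
      abs_of_nonpos (by linarith)]; ring

lemma integrable_mul_abs_sub_add {ξ : ℝ} (hξ : 0 < ξ) :
    Integrable fun η : ℝ => η * |ξ - η| + (ξ - η) * |η| := by
  rw [mul_abs_sub_add_eq_indicator hξ, integrable_indicator_iff measurableSet_Ioc]
  exact (Continuous.integrableOn_Icc (by fun_prop)).mono_set Set.Ioc_subset_Icc_self

lemma integral_mul_abs_sub_add {ξ : ℝ} (hξ : 0 < ξ) :
    ∫ η : ℝ, (η * |ξ - η| + (ξ - η) * |η|) = ξ ^ 3 / 3 := by
  rw [mul_abs_sub_add_eq_indicator hξ, integral_indicator measurableSet_Ioc,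
    ← intervalIntegral.integral_of_le hξ.le, intervalIntegral.integral_const_mul,
    intervalIntegral.integral_sub (Continuous.intervalIntegrable (by fun_prop) _ _)
      (Continuous.intervalIntegrable (by fun_prop) _ _),
    intervalIntegral.integral_const_mul, integral_id, integral_pow]
  norm_num; ring

lemma integrable_sub_mul_h_mul_exp (ξ : ℝ) :
    Integrable fun η => (ξ - η) * (h η * Real.exp (-(Real.pi * |η|))) := by
  simp only [sub_mul]
  exact (integrable_h_mul_exp.const_mul ξ).sub integrable_mul_h_mul_exp

lemma integral_sub_mul_h_mul_exp (ξ : ℝ) :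
    ∫ η, (ξ - η) * (h η * Real.exp (-(Real.pi * |η|))) = ξ / 2 := by
  simp only [sub_mul]
  rw [integral_sub (integrable_h_mul_exp.const_mul ξ) integrable_mul_h_mul_exp,
    integral_const_mul, integral_h_mul_exp, integral_mul_h_mul_exp]
  ring

lemma integral_h_mul_h_sub_of_pos {ξ : ℝ} (hξ : 0 < ξ) :
    ∫ η, h η * h (ξ - η) = (1 + ξ ^ 2) * h ξ := by
  have hr := integrable_sub_mul_h_mul_exp ξ
  have hl : Integrable fun η => η * (h (ξ - η) * Real.exp (-(Real.pi * |ξ - η|))) := by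
    simpa using hr.comp_sub_left ξ
  have hle : ∫ η, η * (h (ξ - η) * Real.exp (-(Real.pi * |ξ - η|))) = ξ / 2 := by
    rw [← integral_sub_mul_h_mul_exp, ← integral_sub_left_eq_self _ volume ξ]
    simp
  have hs : 0 < Real.sinh (Real.pi * ξ) := Real.sinh_pos_iff.2 (by positivity)
  -- The polynomial piece contributes `9 * ξ³ / 3`, each damped piece `3 * ξ / 2`.
  have key : Real.sinh (Real.pi * ξ) * ∫ η, h η * h (ξ - η) = 3 * ξ * (1 + ξ ^ 2) := by
    rw [← integral_const_mul]
    simp only [sinh_mul_h_mul_h_sub]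
    have h12 : Integrable fun η => 9 * (η * |ξ - η| + (ξ - η) * |η|)
        + 3 * (η * (h (ξ - η) * Real.exp (-(Real.pi * |ξ - η|)))) :=
      ((integrable_mul_abs_sub_add hξ).const_mul 9).add (hl.const_mul 3)
    rw [integral_add h12 (hr.const_mul 3), integral_add ((integrable_mul_abs_sub_add hξ).const_mul 9)
      (hl.const_mul 3), integral_const_mul, integral_const_mul, integral_const_mul,
      integral_mul_abs_sub_add hξ, hle, integral_sub_mul_h_mul_exp]
    ring
  refine mul_left_cancel₀ hs.ne' ?_
  rw [key]
  linear_combination (-(1 + ξ ^ 2)) * h_mul_sinh ξ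

lemma integral_h_mul_h_sub_neg (ξ : ℝ) : ∫ η, h η * h (-ξ - η) = ∫ η, h η * h (ξ - η) := by
  rw [← integral_neg_eq_self]
  refine integral_congr_ae (ae_of_all _ fun η => ?_)
  simp only [h_neg]
  rw [← h_neg (ξ - η)]; ring_nf

/-- The convolution identity `h * h = (1 + ξ²) h`. -/
lemma integral_h_mul_h_sub (ξ : ℝ) : ∫ η, h η * h (ξ - η) = (1 + ξ ^ 2) * h ξ := by
  rcases lt_trichotomy ξ 0 with hξ | hξ | hξ
  · rw [← integral_h_mul_h_sub_neg, integral_h_mul_h_sub_of_pos (neg_pos.2 hξ), h_neg, neg_sq]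
  -- At `ξ = 0` the factor `sinh (π ξ)` cannot be cancelled; both sides are continuous, so the
  -- identity passes to the limit from the right.
  · subst hξ
    have h1 := (continuous_integral_h_mul_h_sub.tendsto 0).mono_left
      (nhdsWithin_le_nhds (s := Set.Ioi 0))
    have h2 : Continuous fun ξ => (1 + ξ ^ 2) * h ξ := by have := continuous_h; fun_prop
    refine tendsto_nhds_unique h1 (((h2.tendsto 0).mono_left
      (nhdsWithin_le_nhds (s := Set.Ioi 0))).congr' ?_)
    filter_upwards [self_mem_nhdsWithin] with ξ hξ using (integral_h_mul_h_sub_of_pos hξ).symm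
  · exact integral_h_mul_h_sub_of_pos hξ

/-! ### The measure `γ`: normalisation, reversibility, ergodicity -/

lemma integrable_one_add_sq_mul_h_sq : Integrable fun x => (1 + x ^ 2) * h x ^ 2 := by
  refine Integrable.mono' (integrable_h.const_mul (3 / Real.pi))
    (by have := continuous_h; fun_prop) (ae_of_all _ fun x => ?_)
  have h0 := h_pos x
  rw [Real.norm_of_nonneg (by positivity), pow_two (h x), ← mul_assoc]
  exact mul_le_mul_of_nonneg_right (one_add_sq_mul_h_le x) h0.le

lemma integrable_h_sq : Integrable fun x => h x ^ 2 := by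
  have := integrable_h_mul_h_sub 0
  simpa [h_neg, pow_two] using this

lemma integral_h_sq : ∫ x, h x ^ 2 = 3 / Real.pi := by
  have := integral_h_mul_h_sub 0
  simpa [h_neg, ← pow_two, h_zero] using this

lemma integral_sq_mul_h_sq : ∫ x, x ^ 2 * h x ^ 2 = 3 / (5 * Real.pi) := by
  have := integral_comp_abs (f := fun x => x ^ 2 * h x ^ 2)
  simp only [h_abs, sq_abs] at this
  rw [this, integral_Ioi_sq_mul_h_sq]
  field_simp; norm_num

lemma integral_one_add_sq_mul_h_sq : ∫ x, (1 + x ^ 2) * h x ^ 2 = 18 / (5 * Real.pi) := by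
  have h1 : Integrable fun x => x ^ 2 * h x ^ 2 := by
    refine (integrable_one_add_sq_mul_h_sq.sub integrable_h_sq).congr (ae_of_all _ fun x => ?_)
    simp only [Pi.sub_apply]; ring
  simp only [add_mul, one_mul]
  rw [integral_add integrable_h_sq h1, integral_h_sq, integral_sq_mul_h_sq]
  field_simp; norm_num

instance isProbabilityMeasure_γ : IsProbabilityMeasure γ where
  measure_univ := by
    rw [γ, withDensity_apply _ MeasurableSet.univ, Measure.restrict_univ,
      ← ofReal_integral_eq_lintegral_ofReal (integrable_one_add_sq_mul_h_sq.const_mul _)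
        (ae_of_all _ fun x => by positivity), integral_const_mul, integral_one_add_sq_mul_h_sq,
      ENNReal.ofReal_eq_one]
    field_simp

lemma dens_pos (ξ η : ℝ) : 0 < dens ξ η :=
  div_pos (mul_pos (h_pos _) (h_pos _)) (mul_pos (by positivity) (h_pos _))

lemma kernel_apply (ξ : ℝ) :
    kernel ξ = volume.withDensity fun η => ENNReal.ofReal (dens ξ η) := rfl

lemma measurable_dens_right (ξ : ℝ) : Measurable (dens ξ) :=
  measurable_dens.comp measurable_prodMk_left

instance isMarkovKernel_kernel : IsMarkovKernel kernel where
  isProbabilityMeasure ξ := ⟨by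
    rw [kernel_apply, withDensity_apply _ MeasurableSet.univ, Measure.restrict_univ,
      ← ofReal_integral_eq_lintegral_ofReal (f := dens ξ)
        ((integrable_h_mul_h_sub ξ).div_const ((1 + ξ ^ 2) * h ξ))
        (ae_of_all _ fun η => (dens_pos ξ η).le), ENNReal.ofReal_eq_one]
    unfold dens
    rw [integral_div, integral_h_mul_h_sub, div_self]
    exact (mul_pos (by positivity) (h_pos _)).ne'⟩

lemma γ_absolutelyContinuous : γ ≪ (volume : Measure ℝ) := withDensity_absolutelyContinuous _ _

lemma absolutelyContinuous_γ : (volume : Measure ℝ) ≪ γ := by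
  refine withDensity_absolutelyContinuous' ?_ (ae_of_all _ fun x => ?_)
  · have := measurable_h; fun_prop
  · have := h_pos x
    simp; positivity

lemma kernel_absolutelyContinuous (ξ : ℝ) : kernel ξ ≪ (volume : Measure ℝ) :=
  withDensity_absolutelyContinuous _ _

lemma absolutelyContinuous_kernel (ξ : ℝ) : (volume : Measure ℝ) ≪ kernel ξ := by
  refine withDensity_absolutelyContinuous' (measurable_dens_right ξ).ennreal_ofReal.aemeasurable
    (ae_of_all _ fun x => ?_)
  simp [dens_pos]

/-- The weight `(1 + x²) h(x)²` cancels the denominator of `dens`, leaving a density symmetric in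
`x` and `y` because `h` is even. -/
lemma setLIntegral_kernel_γ {A B : Set ℝ} (hA : MeasurableSet A) (hB : MeasurableSet B) :
    ∫⁻ x in A, kernel x B ∂γ = ∫⁻ x in A, ∫⁻ y in B,
      ENNReal.ofReal (5 * Real.pi / 18 * (h x * h y * h (x - y))) := by
  have hm := measurable_h
  rw [γ, setLIntegral_withDensity_eq_setLIntegral_mul _ (by fun_prop) (kernel.measurable_coe hB) hA]
  refine lintegral_congr fun x => ?_
  rw [Pi.mul_apply, kernel_apply, withDensity_apply _ hB,
    ← lintegral_const_mul _ (measurable_dens_right x).ennreal_ofReal]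
  refine lintegral_congr fun y => ?_
  rw [← ENNReal.ofReal_mul (by positivity)]
  congr 1
  have := h_pos x
  unfold dens
  field_simp

lemma isReversible_γ : kernel.IsReversible γ := by
  intro A B hA hB
  have hm := measurable_h
  rw [setLIntegral_kernel_γ hA hB, setLIntegral_kernel_γ hB hA, lintegral_lintegral_swap]
  · refine lintegral_congr fun x => lintegral_congr fun y => ?_
    rw [← h_neg (x - y), neg_sub, mul_comm (h x)]
  · exact Measurable.aemeasurable (by fun_prop)

lemma invariant_γ : kernel.Invariant γ := isReversible_γ.invariant

lemma absolutelyContinuous_of_invariant {μ : Measure ℝ} (hμ : kernel.Invariant μ) :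
    μ ≪ (volume : Measure ℝ) := by
  intro s hs
  obtain ⟨t, hst, ht, h0⟩ := exists_measurable_superset_of_null hs
  refine measure_mono_null hst ?_
  rw [← hμ.def, Measure.bind_apply ht kernel.measurable.aemeasurable]
  simp [kernel_absolutelyContinuous _ h0]

lemma ergodic_γ {A : Set ℝ} (hA : MeasurableSet A)
    (h : ∀ᵐ x ∂γ, kernel x A = A.indicator 1 x) : γ A = 0 ∨ γ A = 1 := by
  by_cases h0 : γ A = 0
  · exact Or.inl h0
  · right
    -- A set of positive `γ`-measure is charged from every starting point, so the indicator in the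
    -- hypothesis can vanish only on a null set.
    have hpos : ∀ x, kernel x A ≠ 0 := fun x hx =>
      h0 (γ_absolutelyContinuous (absolutelyContinuous_kernel x hx))
    refine (prob_compl_eq_zero_iff hA).1 (measure_mono_null (fun x hx => ?_) h)
    intro hx2
    exact hpos x (by rw [hx2, Set.indicator_of_notMem hx])

end KPP

/-! ### Uniqueness of the invariant law -/

/-- A Markov kernel all of whose transition laws dominate a measure `m` has at most one invariant
probability measure that is absolutely continuous with respect to `m`. -/
lemma ProbabilityTheory.Kernel.Invariant.eq_of_absolutelyContinuous {S : Type*} [MeasurableSpace S]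
    {κ : Kernel S S} [IsMarkovKernel κ] {m μ ν : Measure S} [IsProbabilityMeasure μ]
    [IsProbabilityMeasure ν] (hκ : ∀ x, m ≪ κ x) (hμ : κ.Invariant μ) (hν : κ.Invariant ν)
    (hμm : μ ≪ m) (hνm : ν ≪ m) : μ = ν := by
  obtain ⟨s, hs, hle, hge⟩ := hahn_decomposition μ ν
  have hle' : ν.restrict s ≤ μ.restrict s := Measure.le_iff.2 fun t ht => by
    rw [Measure.restrict_apply ht, Measure.restrict_apply ht]
    exact hle _ (ht.inter hs) Set.inter_subset_right
  have hge' : μ.restrict sᶜ ≤ ν.restrict sᶜ := Measure.le_iff.2 fun t ht => by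
    rw [Measure.restrict_apply ht, Measure.restrict_apply ht]
    exact hge _ (ht.inter hs.compl) Set.inter_subset_right
  have hms := κ.measurable_coe hs
  have hmc := κ.measurable_coe hs.compl
  -- Stationary balance: the mass leaving `s` in one step equals the mass entering it.
  have flow : ∀ ρ : Measure S, IsProbabilityMeasure ρ → κ.Invariant ρ →
      ∫⁻ x in s, κ x sᶜ ∂ρ = ∫⁻ x in sᶜ, κ x s ∂ρ := by
    intro ρ _ hρ
    have h1 : ∫⁻ x in s, κ x s ∂ρ + ∫⁻ x in sᶜ, κ x s ∂ρ = ρ s := by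
      rw [lintegral_add_compl _ hs, ← Measure.bind_apply hs κ.measurable.aemeasurable, hρ.def]
    have h2 : ∫⁻ x in s, κ x s ∂ρ + ∫⁻ x in s, κ x sᶜ ∂ρ = ρ s := by
      rw [← lintegral_add_left hms]
      simp [measure_add_measure_compl hs]
    refine (ENNReal.add_right_inj (a := ∫⁻ x in s, κ x s ∂ρ) ?_).1 (h2.trans h1.symm)
    exact ne_top_of_le_ne_top (measure_ne_top ρ s) (le_self_add.trans h1.le)
  -- Balance turns `μ ≤ ν` on `sᶜ` into a bound on the outflow from `s`, against `ν ≤ μ` there; so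
  -- the excess `ρ` of `μ` over `ν` on `s` sends no mass to `sᶜ`.
  have hflow : ∫⁻ x in s, κ x sᶜ ∂μ ≤ ∫⁻ x in s, κ x sᶜ ∂ν := by
    rw [flow μ inferInstance hμ, flow ν inferInstance hν]
    exact lintegral_mono' hge' le_rfl
  set ρ := μ.restrict s - ν.restrict s with hρ
  have hsum : ρ + ν.restrict s = μ.restrict s := Measure.sub_add_cancel_of_le hle'
  have hzero : ∫⁻ x, κ x sᶜ ∂ρ = 0 := by
    rw [← hsum, lintegral_add_measure] at hflow
    have hfin : ∫⁻ x in s, κ x sᶜ ∂ν ≠ ⊤ := by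
      refine ne_top_of_le_ne_top (measure_ne_top ν s) ?_
      calc ∫⁻ x in s, κ x sᶜ ∂ν ≤ ∫⁻ x in s, 1 ∂ν := lintegral_mono fun x => prob_le_one
        _ = ν s := by simp
    by_contra h0
    exact absurd hflow (not_le.2 (by rw [add_comm]; exact ENNReal.lt_add_right hfin h0))
  -- If `ρ ≠ 0`, some `x` has `κ x sᶜ = 0`, so `sᶜ` is null for `m`, hence for `μ` and `ν`. Then `μ`
  -- and `ν` both give `s` mass one, and no excess is left.
  have hρ0 : ρ = 0 := by
    by_contra hne
    have hae : ∀ᵐ x ∂ρ, κ x sᶜ = 0 := (lintegral_eq_zero_iff hmc).1 hzero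
    have : (ae ρ).NeBot := ae_neBot.2 hne
    obtain ⟨x, hx⟩ := hae.exists
    have hμs : μ s = 1 := (prob_compl_eq_zero_iff hs).1 (hμm (hκ x hx))
    have hνs : ν s = 1 := (prob_compl_eq_zero_iff hs).1 (hνm (hκ x hx))
    have h1 := congrArg (fun τ : Measure S => τ Set.univ) hsum
    simp only [Measure.add_apply, Measure.restrict_apply_univ, hμs, hνs] at h1
    have h2 : ρ Set.univ + 1 = 0 + 1 := by rw [h1, zero_add]
    exact hne (Measure.measure_univ_eq_zero.1 ((ENNReal.add_left_inj ENNReal.one_ne_top).1 h2))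
  rw [hρ0, zero_add] at hsum
  refine Measure.eq_of_le_of_isProbabilityMeasure ?_
  rw [← Measure.restrict_add_restrict_compl (μ := μ) hs,
    ← Measure.restrict_add_restrict_compl (μ := ν) hs, hsum]
  exact add_le_add le_rfl hge'

/-- The Cauchy-Schwarz inequality for the lower Lebesgue integral. -/
lemma MeasureTheory.lintegral_mul_sq_le {α : Type*} [MeasurableSpace α] (μ : Measure α)
    {f g : α → ℝ≥0∞} (hf : AEMeasurable f μ) (hg : AEMeasurable g μ) :
    (∫⁻ a, f a * g a ∂μ) ^ 2 ≤ (∫⁻ a, f a ^ 2 ∂μ) * ∫⁻ a, g a ^ 2 ∂μ := by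
  have := ENNReal.lintegral_mul_le_Lp_mul_Lq μ (p := 2) (q := 2)
    (by constructor <;> norm_num) hf hg
  simp only [Pi.mul_apply, ENNReal.rpow_two] at this
  calc (∫⁻ a, f a * g a ∂μ) ^ 2
      ≤ ((∫⁻ a, f a ^ 2 ∂μ) ^ (1 / 2 : ℝ) * (∫⁻ a, g a ^ 2 ∂μ) ^ (1 / 2 : ℝ)) ^ 2 := by gcongr
    _ = _ := by
      rw [mul_pow, ← ENNReal.rpow_two, ← ENNReal.rpow_two, ← ENNReal.rpow_mul, ← ENNReal.rpow_mul]
      norm_num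

/-! ### The trace condition and the damped Hilbert-Schmidt norm -/

namespace KPP

lemma dens_mul_dens (x y : ℝ) :
    dens x y * dens y x = (1 + x ^ 2)⁻¹ * ((1 + y ^ 2)⁻¹ * h (x - y) ^ 2) := by
  have hx := h_pos x
  have hy := h_pos y
  unfold dens
  rw [← h_neg (y - x), neg_sub]
  field_simp

lemma dens_div_dens_mul (x y : ℝ) :
    dens x y / dens y x * ((1 + x ^ 2) * h x ^ 2) = (1 + y ^ 2) * h y ^ 2 := by
  have hx := h_pos x
  have hy := h_pos y
  have hxy := h_pos (x - y)
  unfold dens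
  rw [← h_neg (y - x), neg_sub]
  field_simp

/-- In `p(x, y) p(y, x)` all values of `h` cancel except `h (x - y)²`. Dropping `(1 + y²)⁻¹` leaves
`∫ h² = 3 / π`, and the remaining `(1 + x²)⁻¹` is integrable. -/
lemma twoStepDiag_le (x : ℝ) : Cascade.twoStepDiag dens volume x
    ≤ ENNReal.ofReal (3 / Real.pi * (1 + x ^ 2)⁻¹) := by
  have hi : Integrable fun y => h (x - y) ^ 2 := integrable_h_sq.comp_sub_left x
  unfold Cascade.twoStepDiag
  calc ∫⁻ y, ENNReal.ofReal (dens x y) * ENNReal.ofReal (dens y x)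
      ≤ ∫⁻ y, ENNReal.ofReal ((1 + x ^ 2)⁻¹ * h (x - y) ^ 2) := by
        refine lintegral_mono fun y => ?_
        rw [← ENNReal.ofReal_mul (dens_pos x y).le, dens_mul_dens]
        refine ENNReal.ofReal_le_ofReal (mul_le_mul_of_nonneg_left ?_ (by positivity))
        exact mul_le_of_le_one_left (sq_nonneg _)
          (inv_le_one_of_one_le₀ (by nlinarith [sq_nonneg y]))
    _ = _ := by
        rw [← ofReal_integral_eq_lintegral_ofReal (hi.const_mul _)
          (ae_of_all _ fun y => by positivity), integral_const_mul,
          integral_sub_left_eq_self (fun y => h y ^ 2) volume x, integral_h_sq, mul_comm]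

lemma lintegral_twoStepDiag_lt_top :
    ∫⁻ x, Cascade.twoStepDiag dens volume x < ⊤ :=
  (lintegral_mono twoStepDiag_le).trans_lt
    (integrable_inv_one_add_sq.const_mul (3 / Real.pi)).lintegral_lt_top

lemma measurable_twoStepDiag : Measurable (Cascade.twoStepDiag dens (volume : Measure ℝ)) := by
  unfold Cascade.twoStepDiag
  refine Measurable.lintegral_prod_right'
    (f := fun q : ℝ × ℝ => ENNReal.ofReal (dens q.1 q.2) * ENNReal.ofReal (dens q.2 q.1)) ?_
  exact measurable_dens.ennreal_ofReal.mul (measurable_dens.comp measurable_swap).ennreal_ofReal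

lemma lam_pos (x : ℝ) : 0 < lam x := by unfold lam; positivity

/-- The killing factor `λ / (λ + θ)`. -/
noncomputable def damp (θ x : ℝ) : ℝ≥0∞ := ENNReal.ofReal (lam x / (lam x + θ))

lemma measurable_damp (θ : ℝ) : Measurable (damp θ) := by
  unfold damp lam
  fun_prop

lemma damp_le_one {θ : ℝ} (hθ : 0 ≤ θ) (x : ℝ) : damp θ x ≤ 1 := by
  have := lam_pos x
  rw [damp, ENNReal.ofReal_le_one, div_le_one (by positivity)]
  linarith

lemma traceCondition : Cascade.TraceCondition lam dens (volume : Measure ℝ) := by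
  refine lt_of_le_of_lt (lintegral_mono fun x => ?_) lintegral_twoStepDiag_lt_top
  refine mul_le_of_le_one_left zero_le ?_
  have := lam_pos x
  rw [ENNReal.ofReal_le_one]
  exact pow_le_one₀ (by positivity) ((div_le_one (by positivity)).2 (by linarith))

/-- The squared Hilbert-Schmidt norm of the damped transition operator tends to zero. -/
lemma tendsto_lintegral_damp_sq_mul_twoStepDiag :
    Filter.Tendsto (fun n : ℕ => ∫⁻ x, damp n x ^ 2 * Cascade.twoStepDiag dens volume x)
      Filter.atTop (nhds 0) := by
  have h0 : ∫⁻ _ : ℝ, (0 : ℝ≥0∞) = 0 := lintegral_zero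
  rw [← h0]
  refine tendsto_lintegral_of_dominated_convergence (Cascade.twoStepDiag dens volume)
    (fun n => ((measurable_damp n).pow_const 2).mul measurable_twoStepDiag)
    (fun n => ae_of_all _ fun x => ?_) lintegral_twoStepDiag_lt_top.ne (ae_of_all _ fun x => ?_)
  · exact mul_le_of_le_one_left zero_le (pow_le_one₀ zero_le (damp_le_one n.cast_nonneg x))
  · have h1 : Filter.Tendsto (fun n : ℕ => damp n x) Filter.atTop (nhds 0) := by
      rw [← ENNReal.ofReal_zero]
      refine ENNReal.tendsto_ofReal (Filter.Tendsto.div_atTop tendsto_const_nhds ?_)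
      exact Filter.tendsto_atTop_add_const_left _ _ tendsto_natCast_atTop_atTop
    have h2 := ENNReal.Tendsto.mul_const (b := Cascade.twoStepDiag dens volume x)
      (((ENNReal.continuous_pow 2).tendsto 0).comp h1)
      (Or.inr (ne_top_of_le_ne_top ENNReal.ofReal_ne_top (twoStepDiag_le x)))
    simpa using h2

end KPP

/-! ### Feynman-Kac functionals and their decay -/

namespace Cascade

variable {S : Type*} [MeasurableSpace S]

/-- The Feynman-Kac functional `x ↦ E_x[g(Y 0) ⋯ g(Y n)]` of the chain with kernel `κ`. -/
noncomputable def feynmanKac (κ : Kernel S S) (g : S → ℝ≥0∞) : ℕ → S → ℝ≥0∞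
  | 0 => g
  | n + 1 => fun x => g x * ∫⁻ y, feynmanKac κ g n y ∂κ x

lemma measurable_feynmanKac (κ : Kernel S S) {g : S → ℝ≥0∞} (hg : Measurable g) (n : ℕ) :
    Measurable (feynmanKac κ g n) := by
  induction n with
  | zero => exact hg
  | succ n ih => exact hg.mul ih.lintegral_kernel

end Cascade

namespace KPP
open Cascade

/-- The density of `γ` up to normalisation. -/
noncomputable def weight (x : ℝ) : ℝ≥0∞ := ENNReal.ofReal ((1 + x ^ 2) * h x ^ 2)

lemma weight_ne_zero (x : ℝ) : weight x ≠ 0 := by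
  have := h_pos x
  simp only [weight, ne_eq, ENNReal.ofReal_eq_zero, not_le]
  positivity

lemma lintegral_weight_lt_top : ∫⁻ x, weight x < ⊤ :=
  integrable_one_add_sq_mul_h_sq.lintegral_lt_top

/-- Cauchy-Schwarz after writing `p(x, y) = √(p(x, y) p(y, x)) * √(p(x, y) / p(y, x))`: the first
factor squares to the integrand of the two-step diagonal, and by reversibility the second squares to
`weight y / weight x`. -/
lemma lintegral_kernel_sq_mul_weight_le {u : ℝ → ℝ≥0∞} (hu : Measurable u) (x : ℝ) :
    (∫⁻ y, u y ∂kernel x) ^ 2 * weight x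
      ≤ twoStepDiag dens volume x * ∫⁻ y, u y ^ 2 * weight y := by
  have hm1 : Measurable fun y => dens x y := measurable_dens_right x
  have hm2 : Measurable fun y => dens y x := measurable_dens.comp measurable_prodMk_right
  have e : ∫⁻ y, u y ∂kernel x = ∫⁻ y, ENNReal.ofReal (√(dens x y * dens y x))
      * (ENNReal.ofReal (√(dens x y / dens y x)) * u y) := by
    rw [kernel_apply, lintegral_withDensity_eq_lintegral_mul _ hm1.ennreal_ofReal hu]
    refine lintegral_congr fun y => ?_
    have h1 := dens_pos x y
    have h2 := dens_pos y x
    rw [Pi.mul_apply, ← mul_assoc, ← ENNReal.ofReal_mul (Real.sqrt_nonneg _), ← Real.sqrt_mul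
      (by positivity), show dens x y * dens y x * (dens x y / dens y x) = dens x y ^ 2 by
        field_simp, Real.sqrt_sq h1.le]
  have hcs := lintegral_mul_sq_le volume
    (f := fun y => ENNReal.ofReal (√(dens x y * dens y x)))
    (g := fun y => ENNReal.ofReal (√(dens x y / dens y x)) * u y)
    (by fun_prop) (by fun_prop)
  rw [e]
  refine (mul_le_mul_left hcs _).trans (le_of_eq ?_)
  rw [mul_assoc]
  refine congrArg₂ (· * ·) ?_ ((lintegral_mul_const _ (by fun_prop)).symm.trans ?_)
  · refine lintegral_congr fun y => ?_
    have h1 := dens_pos x y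
    have h2 := dens_pos y x
    rw [← ENNReal.ofReal_pow (Real.sqrt_nonneg _), Real.sq_sqrt (by positivity),
      ENNReal.ofReal_mul h1.le]
  · refine lintegral_congr fun y => ?_
    have h1 := dens_pos x y
    have h2 := dens_pos y x
    rw [mul_pow, ← ENNReal.ofReal_pow (Real.sqrt_nonneg _), Real.sq_sqrt (by positivity),
      mul_right_comm, weight, ← ENNReal.ofReal_mul (by positivity), dens_div_dens_mul, mul_comm,
      weight]

lemma feynmanKac_succ_sq_mul_weight_le (θ : ℝ) (n : ℕ) (x : ℝ) :
    feynmanKac kernel (damp θ) (n + 1) x ^ 2 * weight x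
      ≤ damp θ x ^ 2 * twoStepDiag dens volume x
        * ∫⁻ y, feynmanKac kernel (damp θ) n y ^ 2 * weight y := by
  rw [feynmanKac, mul_pow, mul_assoc, mul_assoc]
  refine mul_le_mul' le_rfl ?_
  exact lintegral_kernel_sq_mul_weight_le (measurable_feynmanKac _ (measurable_damp θ) n) x

lemma lintegral_feynmanKac_sq_mul_weight_le {θ : ℝ} (hθ : 0 ≤ θ) (n : ℕ) :
    ∫⁻ y, feynmanKac kernel (damp θ) n y ^ 2 * weight y
      ≤ (∫⁻ x, damp θ x ^ 2 * twoStepDiag dens volume x) ^ n * ∫⁻ y, weight y := by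
  induction n with
  | zero =>
    rw [pow_zero, one_mul]
    exact lintegral_mono fun y =>
      mul_le_of_le_one_left zero_le (pow_le_one₀ zero_le (damp_le_one hθ y))
  | succ n ih =>
    calc _ ≤ ∫⁻ x, damp θ x ^ 2 * twoStepDiag dens volume x
          * ∫⁻ y, feynmanKac kernel (damp θ) n y ^ 2 * weight y :=
        lintegral_mono fun x => feynmanKac_succ_sq_mul_weight_le θ n x
      _ = (∫⁻ x, damp θ x ^ 2 * twoStepDiag dens volume x)
          * ∫⁻ y, feynmanKac kernel (damp θ) n y ^ 2 * weight y :=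
        lintegral_mul_const _ (((measurable_damp θ).pow_const 2).mul measurable_twoStepDiag)
      _ ≤ _ := by rw [pow_succ', mul_assoc]; gcongr

/-- For a suitable damping rate, the Feynman-Kac functional decays faster than `2⁻ⁿ`. -/
lemma exists_tendsto_two_pow_mul_feynmanKac : ∃ θ : ℝ, 0 ≤ θ ∧ ∀ x : ℝ,
    Filter.Tendsto (fun n : ℕ => 2 ^ n * feynmanKac kernel (damp θ) n x)
      Filter.atTop (nhds 0) := by
  obtain ⟨N, hN⟩ := (tendsto_lintegral_damp_sq_mul_twoStepDiag.eventually_le_const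
    (show (0 : ℝ≥0∞) < 8⁻¹ by simp)).exists
  refine ⟨N, N.cast_nonneg, fun x => ?_⟩
  -- The `L²` bound controls the functional after `n` steps; one further transition turns it into a
  -- bound at every point `x`, not merely almost everywhere.
  rw [← Filter.tendsto_add_atTop_iff_nat 1]
  set C : ℝ≥0∞ := 4 * (twoStepDiag dens volume x * (∫⁻ y, weight y)) / weight x with hC
  have hCt : C ≠ ⊤ := by
    refine ENNReal.div_ne_top (ENNReal.mul_ne_top (by simp) (ENNReal.mul_ne_top
      (ne_top_of_le_ne_top ENNReal.ofReal_ne_top (twoStepDiag_le x)) lintegral_weight_lt_top.ne))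
      (weight_ne_zero x)
  have hle : ∀ n : ℕ, (2 ^ (n + 1) * feynmanKac kernel (damp N) (n + 1) x) ^ 2
      ≤ C * 2⁻¹ ^ n := by
    intro n
    have h1 : feynmanKac kernel (damp N) (n + 1) x ^ 2 * weight x
        ≤ twoStepDiag dens volume x * (8⁻¹ ^ n * ∫⁻ y, weight y) :=
      (feynmanKac_succ_sq_mul_weight_le N n x).trans (mul_le_mul'
        (mul_le_of_le_one_left zero_le (pow_le_one₀ zero_le (damp_le_one N.cast_nonneg x)))
        ((lintegral_feynmanKac_sq_mul_weight_le N.cast_nonneg n).trans (by gcongr)))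
    have h4 : (4 : ℝ≥0∞) ^ n * 8⁻¹ ^ n = 2⁻¹ ^ n := by
      rw [← mul_pow]
      congr 1
      rw [show (8 : ℝ≥0∞) = 4 * 2 by norm_num, ENNReal.mul_inv (by simp) (by simp), ← mul_assoc,
        ENNReal.mul_inv_cancel (by simp) (by simp), one_mul]
    rw [hC, ENNReal.mul_div_right_comm.symm, ENNReal.le_div_iff_mul_le
      (Or.inl (weight_ne_zero x)) (Or.inl ENNReal.ofReal_ne_top)]
    calc _ = 4 * 4 ^ n * (feynmanKac kernel (damp N) (n + 1) x ^ 2 * weight x) := by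
          rw [mul_pow, ← pow_mul, mul_comm (n + 1) 2, pow_mul, pow_succ']; norm_num; ring
      _ ≤ 4 * 4 ^ n * (twoStepDiag dens volume x * (8⁻¹ ^ n * ∫⁻ y, weight y)) := by gcongr
      _ = _ := by rw [← h4]; ring
  have ht : Filter.Tendsto (fun n : ℕ => C * 2⁻¹ ^ n) Filter.atTop (nhds 0) := by
    have := ENNReal.Tendsto.const_mul (a := C) (ENNReal.tendsto_pow_atTop_nhds_zero_of_lt_one
      (r := 2⁻¹) (by simp)) (Or.inr hCt)
    simpa using this
  have hsq := tendsto_of_tendsto_of_tendsto_of_le_of_le tendsto_const_nhds ht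
    (fun _ => zero_le) hle
  have := ((ENNReal.continuous_rpow_const (y := 1 / 2)).tendsto 0).comp hsq
  rw [ENNReal.zero_rpow_of_pos (by norm_num)] at this
  refine this.congr fun n => ?_
  simp only [Function.comp]
  rw [← ENNReal.rpow_two, ← ENNReal.rpow_mul]
  norm_num

end KPP

/-! ### From path functionals to non-explosion -/

namespace Cascade

lemma setOf_explosionTime_lt_subset {Ω : Type*} (lam T : Vertex → Ω → ℝ) (a n : ℕ) :
    {ω | explosionTime lam T ω < a} ⊆ ⋃ f : Fin n → Fin 2,
      {ω | ∑ j ∈ Finset.range ((List.ofFn f).length + 1),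
        ENNReal.ofReal (T ((List.ofFn f).take j) ω / lam ((List.ofFn f).take j) ω) ≤ a} := by
  intro ω hω
  have h1 := (le_iSup (fun n : ℕ => ⨅ (v : Vertex) (_ : v.length = n),
    ∑ j ∈ Finset.range (n + 1), ENNReal.ofReal (T (v.take j) ω / lam (v.take j) ω)) n).trans_lt hω
  simp only [iInf_lt_iff] at h1
  obtain ⟨v, rfl, hv⟩ := h1
  refine Set.mem_iUnion.2 ⟨v.get, ?_⟩
  simp only [Set.mem_ofPred_eq, List.ofFn_get]
  exact hv.le

section

variable {Ω : Type*} [MeasurableSpace Ω] {S : Type*} [MeasurableSpace S]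

lemma IsMarkovChain.lintegral_prod_mul_lintegral_kernel {κ : Kernel S S} [IsSFiniteKernel κ]
    {Y : ℕ → Ω → S} {P : Measure Ω} [SFinite P] (hY : IsMarkovChain κ Y P)
    (hYm : ∀ n, Measurable (Y n)) {g u : S → ℝ≥0∞} (hg : Measurable g) (hu : Measurable u)
    (n : ℕ) :
    ∫⁻ ω, (∏ j ∈ Finset.range (n + 1), g (Y j ω)) * ∫⁻ y, u y ∂κ (Y n ω) ∂P
      = ∫⁻ ω, (∏ j ∈ Finset.range (n + 1), g (Y j ω)) * u (Y (n + 1) ω) ∂P := by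
  have hmap := (hY n).map_eq
  have hpast : Measurable fun ω (i : Fin (n + 1)) => Y i ω :=
    measurable_pi_lambda _ fun i => hYm i
  have hF : Measurable fun q : (Fin (n + 1) → S) × S => (∏ i, g (q.1 i)) * u q.2 := by
    refine Measurable.mul (Finset.measurable_fun_prod _ fun i _ => ?_) (hu.comp measurable_snd)
    exact hg.comp ((measurable_pi_apply i).comp measurable_fst)
  have hG : Measurable fun y : Fin (n + 1) → S => ∫⁻ z, (∏ i, g (y i)) * u z ∂κ (y (Fin.last n)) :=
    Measurable.lintegral_kernel_prod_right' (κ := κ.comap (fun y : Fin (n + 1) → S =>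
      y (Fin.last n)) (measurable_pi_apply _)) hF
  simp only [Finset.prod_range]
  calc _ = ∫⁻ ω, ∫⁻ z, (∏ i : Fin (n + 1), g (Y i ω)) * u z ∂κ (Y n ω) ∂P :=
        lintegral_congr fun ω => (lintegral_const_mul _ hu).symm
    _ = ∫⁻ y, ∫⁻ z, (∏ i, g (y i)) * u z ∂κ (y (Fin.last n))
          ∂P.map (fun ω (i : Fin (n + 1)) => Y i ω) := by
        rw [lintegral_map hG hpast]; rfl
    _ = ∫⁻ q, (∏ i, g (q.1 i)) * u q.2 ∂P.map
          (fun ω => (fun i : Fin (n + 1) => Y i ω, Y (n + 1) ω)) := by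
        rw [hmap, Measure.lintegral_compProd hF]; rfl
    _ = _ := by rw [lintegral_map hF (hpast.prodMk (hYm _))]

/-- The index `n` is kept general so that the induction on `m` can release one factor at a time by
the Markov property; the case `n = 0` is the path representation used later. -/
lemma IsMarkovChain.lintegral_prod_mul_feynmanKac {κ : Kernel S S} [IsSFiniteKernel κ]
    {Y : ℕ → Ω → S} {P : Measure Ω} [SFinite P] (hY : IsMarkovChain κ Y P)
    (hYm : ∀ n, Measurable (Y n)) {g : S → ℝ≥0∞} (hg : Measurable g) (m n : ℕ) :
    ∫⁻ ω, (∏ j ∈ Finset.range n, g (Y j ω)) * feynmanKac κ g m (Y n ω) ∂P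
      = ∫⁻ ω, ∏ j ∈ Finset.range (n + m + 1), g (Y j ω) ∂P := by
  induction m generalizing n with
  | zero => simp only [feynmanKac, add_zero, Finset.prod_range_succ]
  | succ m ih =>
    have := ih (n + 1)
    rw [show n + 1 + m + 1 = n + (m + 1) + 1 by ring] at this
    rw [← this, ← hY.lintegral_prod_mul_lintegral_kernel hYm hg (measurable_feynmanKac κ hg m) n]
    simp only [feynmanKac, Finset.prod_range_succ, mul_assoc]

/-- The Markov property is assumed along infinite paths, so a finite vertex is prolonged by zeros.
-/
lemma restrict_getD (v : Vertex) {j : ℕ} (hj : j ≤ v.length) :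
    restrict (fun i => v.getD i 0) j = v.take j := by
  refine List.ext_getElem (by simp [restrict, hj]) fun i h1 h2 => ?_
  have hi : i < v.length := by simp at h2; omega
  simp [restrict, hi]

lemma lintegral_exp_neg_mul_expMeasure {s : ℝ} (hs : 0 ≤ s) :
    ∫⁻ t, ENNReal.ofReal (Real.exp (-(s * t))) ∂expMeasure 1 = ENNReal.ofReal (1 / (1 + s)) := by
  have h1 := lintegral_exponentialPDF_eq_one (r := 1 + s) (by linarith)
  have hm : Measurable (exponentialPDF 1) := (measurable_exponentialPDFReal 1).ennreal_ofReal
  change ∫⁻ t, _ ∂volume.withDensity (exponentialPDF 1) = _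
  rw [lintegral_withDensity_eq_lintegral_mul _ hm (by fun_prop), ← mul_one (ENNReal.ofReal _), ← h1,
    ← lintegral_const_mul _ (f := exponentialPDF (1 + s))
      (measurable_exponentialPDFReal _).ennreal_ofReal]
  refine lintegral_congr fun t => ?_
  rcases lt_or_ge t 0 with ht | ht
  · simp [exponentialPDF_of_neg ht]
  · rw [Pi.mul_apply, exponentialPDF_of_nonneg ht, exponentialPDF_of_nonneg ht,
      ← ENNReal.ofReal_mul (by positivity), ← ENNReal.ofReal_mul (by positivity)]
    congr 1
    rw [one_mul, one_mul, ← Real.exp_add, ← mul_assoc, one_div_mul_cancel (by positivity), one_mul]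
    ring_nf

/-- Independence of intensities and clocks lets the clocks be integrated first with the intensities
frozen; each contributes `1 / (1 + θ / λ) = λ / (λ + θ)`. -/
lemma IsDSY.lintegral_exp_neg_sum {lam T : Vertex → Ω → ℝ} {P : Measure Ω}
    [IsProbabilityMeasure P] (hD : IsDSY lam T P) {θ : ℝ} (hθ : 0 ≤ θ) (v : Vertex) :
    ∫⁻ ω, ENNReal.ofReal (Real.exp (-(θ * ∑ j ∈ Finset.range (v.length + 1),
        T (v.take j) ω / lam (v.take j) ω))) ∂P
      = ∫⁻ ω, ∏ j ∈ Finset.range (v.length + 1),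
        ENNReal.ofReal (lam (v.take j) ω / (lam (v.take j) ω + θ)) ∂P := by
  set n := v.length with hn
  set p : Fin (n + 1) → Vertex := fun j => v.take j with hp
  -- Distinct generations give distinct ancestors, so the clocks along the line are independent.
  have hpinj : Function.Injective p := fun i j hij => by
    have := congrArg List.length hij
    simp only [hp, List.length_take] at this
    ext; omega
  set A : Ω → Fin (n + 1) → ℝ := fun ω j => lam (p j) ω with hA
  set B : Ω → Fin (n + 1) → ℝ := fun ω j => T (p j) ω with hB
  have hAm : Measurable A := measurable_pi_lambda _ fun j => hD.measurable_lam _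
  have hBm : Measurable B := measurable_pi_lambda _ fun j => hD.measurable_T _
  have hAB : IndepFun A B P := hD.indep_lam_T.comp
    (φ := fun x j => x (p j)) (ψ := fun x j => x (p j))
    (measurable_pi_lambda _ fun j => measurable_pi_apply _)
    (measurable_pi_lambda _ fun j => measurable_pi_apply _)
  have hmap := (indepFun_iff_map_prod_eq_prod_map_map hAm.aemeasurable hBm.aemeasurable).1 hAB
  set Φ : (Fin (n + 1) → ℝ) × (Fin (n + 1) → ℝ) → ℝ≥0∞ :=
    fun q => ∏ j, ENNReal.ofReal (Real.exp (-(θ / q.1 j * q.2 j))) with hΦ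
  have hΦm : Measurable Φ := Finset.measurable_fun_prod _ fun j _ => by fun_prop
  have hprodB : ∀ ω, ∫⁻ ω', Φ (A ω, B ω') ∂P
      = ∏ j, ENNReal.ofReal (A ω j / (A ω j + θ)) := by
    intro ω
    have hind : iIndepFun (fun (j : Fin (n + 1)) ω' =>
        ENNReal.ofReal (Real.exp (-(θ / A ω j * T (p j) ω')))) P :=
      (hD.indep_T.precomp hpinj).comp
        (fun j t => ENNReal.ofReal (Real.exp (-(θ / A ω j * t)))) fun j => by fun_prop
    rw [lintegral_prod_eq_prod_lintegral_of_indepFun _ _ hind fun j => by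
      have := hD.measurable_T (p j); fun_prop]
    refine Finset.prod_congr rfl fun j _ => ?_
    have hpos : 0 < A ω j := hD.lam_pos _ _
    have := (hD.law_T (p j)).map_eq
    rw [← lintegral_map (f := fun t => ENNReal.ofReal (Real.exp (-(θ / A ω j * t)))) (by fun_prop)
      (hD.measurable_T (p j)), this, lintegral_exp_neg_mul_expMeasure (by positivity)]
    congr 1
    field_simp
  simp only [Finset.prod_range]
  calc _ = ∫⁻ ω, Φ (A ω, B ω) ∂P := by
        refine lintegral_congr fun ω => ?_
        simp only [hΦ]
        rw [← ENNReal.ofReal_prod_of_nonneg fun _ _ => (Real.exp_pos _).le, ← Real.exp_sum,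
          Finset.sum_range, Finset.mul_sum, ← Finset.sum_neg_distrib]
        congr 3
        ext j
        simp only [hA, hB, hp]
        ring
    _ = ∫⁻ q, Φ q ∂(P.map A).prod (P.map B) := by
        rw [← hmap, lintegral_map hΦm (hAm.prodMk hBm)]
    _ = ∫⁻ ω, ∫⁻ ω', Φ (A ω, B ω') ∂P ∂P := by
        rw [lintegral_prod _ hΦm.aemeasurable, lintegral_map hΦm.lintegral_prod_right' hAm]
        refine lintegral_congr fun ω => ?_
        exact lintegral_map (hΦm.comp measurable_prodMk_left) hBm
    _ = _ := lintegral_congr hprodB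

/-- The Chernoff bound for the arrival time at a vertex. -/
lemma IsDSY.measure_sum_le_le {lam T : Vertex → Ω → ℝ} {P : Measure Ω}
    [IsProbabilityMeasure P] (hD : IsDSY lam T P) {θ : ℝ} (hθ : 0 ≤ θ) (v : Vertex) (a : ℕ) :
    P {ω | ∑ j ∈ Finset.range (v.length + 1),
        ENNReal.ofReal (T (v.take j) ω / lam (v.take j) ω) ≤ a}
      ≤ ENNReal.ofReal (Real.exp (θ * a)) * ∫⁻ ω, ∏ j ∈ Finset.range (v.length + 1),
        ENNReal.ofReal (lam (v.take j) ω / (lam (v.take j) ω + θ)) ∂P := by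
  have hm : Measurable fun ω => ENNReal.ofReal (Real.exp (-(θ * ∑ j ∈ Finset.range (v.length + 1),
      T (v.take j) ω / lam (v.take j) ω))) := by
    have := hD.measurable_T
    have := hD.measurable_lam
    fun_prop
  rw [← hD.lintegral_exp_neg_sum hθ v, ← lintegral_const_mul _ hm]
  refine le_trans (measure_mono fun ω hω => ?_) ((one_mul _).symm.le.trans
    (mul_meas_ge_le_lintegral (hm.const_mul _) 1))
  simp only [Set.mem_ofPred_eq] at hω ⊢
  have hsum : ∑ j ∈ Finset.range (v.length + 1), T (v.take j) ω / lam (v.take j) ω ≤ a := by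
    -- `ENNReal.ofReal` truncates negative clock values, which are not excluded pointwise;
    -- truncation only enlarges the sum.
    have h1 : ENNReal.ofReal (∑ j ∈ Finset.range (v.length + 1),
        max (T (v.take j) ω / lam (v.take j) ω) 0) ≤ ENNReal.ofReal a := by
      rw [ENNReal.ofReal_sum_of_nonneg fun _ _ => le_max_right _ _]
      simpa using hω
    rw [ENNReal.ofReal_le_ofReal_iff a.cast_nonneg] at h1
    exact (Finset.sum_le_sum fun j _ => le_max_left _ _).trans h1
  rw [← ENNReal.ofReal_mul (Real.exp_pos _).le, ← Real.exp_add, ENNReal.one_le_ofReal,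
    Real.one_le_exp_iff]
  nlinarith

/-- A cascade is non-explosive if the damped path functionals decay faster than `2⁻ⁿ`. -/
lemma IsDSY.isNonExplosive {lam T : Vertex → Ω → ℝ} {P : Measure Ω}
    [IsProbabilityMeasure P] (hD : IsDSY lam T P) {θ : ℝ} (hθ : 0 ≤ θ) {b : ℕ → ℝ≥0∞}
    (hb : ∀ v : Vertex, ∫⁻ ω, ∏ j ∈ Finset.range (v.length + 1),
        ENNReal.ofReal (lam (v.take j) ω / (lam (v.take j) ω + θ)) ∂P ≤ b v.length)
    (hlim : Filter.Tendsto (fun n => 2 ^ n * b n) Filter.atTop (nhds 0)) :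
    IsNonExplosive lam T P := by
  have hlt : ∀ a : ℕ, P {ω | explosionTime lam T ω < a} = 0 := by
    intro a
    -- Union bound over the `2 ^ n` words of length `n`; the left side does not depend on `n`, so it
    -- vanishes in the limit.
    have hle : ∀ n : ℕ, P {ω | explosionTime lam T ω < a}
        ≤ ENNReal.ofReal (Real.exp (θ * a)) * (2 ^ n * b n) := by
      intro n
      refine (measure_mono (setOf_explosionTime_lt_subset lam T a n)).trans ?_
      refine (measure_iUnion_fintype_le _ _).trans ?_
      calc _ ≤ ∑ _f : Fin n → Fin 2, ENNReal.ofReal (Real.exp (θ * a)) * b n := by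
            refine Finset.sum_le_sum fun f _ => (hD.measure_sum_le_le hθ _ a).trans ?_
            gcongr
            simpa only [List.length_ofFn] using hb (List.ofFn f)
        _ = _ := by simp; ring
    have := ENNReal.Tendsto.const_mul (a := ENNReal.ofReal (Real.exp (θ * a))) hlim
      (Or.inr ENNReal.ofReal_ne_top)
    rw [mul_zero] at this
    exact le_antisymm (ge_of_tendsto' this hle) zero_le
  have hae : ∀ᵐ ω ∂P, explosionTime lam T ω = ⊤ := by
    have h1 : ∀ᵐ ω ∂P, ∀ a : ℕ, ¬ explosionTime lam T ω < a :=
      ae_all_iff.2 fun a => by simpa [ae_iff] using hlt a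
    filter_upwards [h1] with ω hω
    by_contra hne
    obtain ⟨a, ha⟩ := ENNReal.exists_nat_gt hne
    exact hω a ha
  have : {ω | explosionTime lam T ω = ⊤} =ᵐ[P] Set.univ := by
    filter_upwards [hae] with ω hω
    exact eq_true hω
  rw [IsNonExplosive, measure_congr this, measure_univ]

end

end Cascade

lemma KPP.isNonExplosive {Ω : Type*} [MeasurableSpace Ω] {P : Measure Ω} [IsProbabilityMeasure P]
    {X T : Cascade.Vertex → Ω → ℝ} {ξ : ℝ}
    (hM : Cascade.IsTypeM KPP.kernel KPP.lam X T P) (hξ : ∀ᵐ ω ∂P, X [] ω = ξ) :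
    Cascade.IsNonExplosive (fun v ω => KPP.lam (X v ω)) T P := by
  obtain ⟨θ, hθ, hlim⟩ := exists_tendsto_two_pow_mul_feynmanKac
  refine hM.isDSY.isNonExplosive hθ (fun v => le_of_eq ?_) (hlim ξ)
  -- The expected product depends on `v` only through its length, as all paths share the kernel and
  -- the starting point `ξ`.
  have h1 := (hM.markov fun i => v.getD i 0).lintegral_prod_mul_feynmanKac
    (fun n => hM.measurable_X _) (measurable_damp θ) v.length 0
  simp only [Finset.range_zero, Finset.prod_empty, one_mul, zero_add] at h1
  calc _ = ∫⁻ ω, ∏ j ∈ Finset.range (v.length + 1),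
        damp θ (X (Cascade.restrict (fun i => v.getD i 0) j) ω) ∂P := by
        refine lintegral_congr fun ω => Finset.prod_congr rfl fun j hj => ?_
        rw [Cascade.restrict_getD v (by simpa [Nat.lt_succ_iff] using hj), damp]
    _ = ∫⁻ ω, Cascade.feynmanKac kernel (damp θ) v.length ξ ∂P := by
        rw [← h1]
        refine lintegral_congr_ae ?_
        filter_upwards [hξ] with ω hω
        rw [← hω]; rfl
    _ = _ := by simp

theorem mainTheorem7 :
    -- `h` is a majorizing kernel: it is positive and `h * h = (1 + ξ²) h`
    (∀ ξ : ℝ, 0 < KPP.h ξ) ∧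
    (∀ ξ : ℝ, Integrable (fun η => KPP.h η * KPP.h (ξ - η)) ∧
      ∫ η, KPP.h η * KPP.h (ξ - η) = (1 + ξ ^ 2) * KPP.h ξ) ∧
    -- `H(η | ξ) dη` is a probability kernel
    IsMarkovKernel KPP.kernel ∧
    -- reversibility with respect to `γ`, the unique invariant distribution; ergodicity
    IsProbabilityMeasure KPP.γ ∧
    KPP.kernel.IsReversible KPP.γ ∧
    (∀ μ : Measure ℝ, IsProbabilityMeasure μ → KPP.kernel.Invariant μ → μ = KPP.γ) ∧
    (∀ A : Set ℝ, MeasurableSet A →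
      (∀ᵐ x ∂KPP.γ, KPP.kernel x A = A.indicator 1 x) → KPP.γ A = 0 ∨ KPP.γ A = 1) ∧
    -- absolute continuity
    (∀ ξ : ℝ, KPP.kernel ξ ≪ KPP.γ) ∧ KPP.γ ≪ (volume : Measure ℝ) ∧
    -- the trace condition, also without the weight
    Cascade.TraceCondition KPP.lam KPP.dens (volume : Measure ℝ) ∧
    (∫⁻ ξ, Cascade.twoStepDiag KPP.dens (volume : Measure ℝ) ξ < ⊤) ∧
    -- non-explosion for every initial wave number
    (∀ (ξ : ℝ) {Ω : Type*} [MeasurableSpace Ω] (P : Measure Ω) [IsProbabilityMeasure P]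
      (X T : Cascade.Vertex → Ω → ℝ),
      Cascade.IsTypeM KPP.kernel KPP.lam X T P → (∀ᵐ ω ∂P, X [] ω = ξ) →
      Cascade.IsNonExplosive (fun v ω => KPP.lam (X v ω)) T P) := by
  refine ⟨KPP.h_pos, fun ξ => ⟨KPP.integrable_h_mul_h_sub ξ, KPP.integral_h_mul_h_sub ξ⟩,
    inferInstance, inferInstance, KPP.isReversible_γ, fun μ _ hμ => ?_,
    fun A hA => KPP.ergodic_γ hA,
    fun ξ => (KPP.kernel_absolutelyContinuous ξ).trans KPP.absolutelyContinuous_γ,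
    KPP.γ_absolutelyContinuous, KPP.traceCondition, KPP.lintegral_twoStepDiag_lt_top,
    fun ξ Ω _ P _ X T hM hξ => KPP.isNonExplosive hM hξ⟩
  exact hμ.eq_of_absolutelyContinuous KPP.absolutelyContinuous_kernel KPP.invariant_γ
    (KPP.absolutelyContinuous_of_invariant hμ) KPP.γ_absolutelyContinuous
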